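/- **Setup.** Let $\mathbb N=\{1,2,\dots\}$, $\mathbf x=(x_1,x_2,\dots)$, $\mathbf t=(t_1,t_2,\dots)$. An *indexed forest* is a sequence $F=(T_1,T_2,\dots)$ of plane binary trees (every internal node has a left and a right child), all but finitely many of them trivial (a single leaf); its leaves are labelled $1,2,\dots$ from left to right. Let $\mathsf{Forest}$ be the set of indexed forests and $\emptyset$ the forest with only trivial trees. $\mathsf{Forest}$ is a monoid: $F\cdot G$ is obtained by attaching, for each $i$, the $i$-th leaf of $F$ to the root of the $i$-th tree of $G$. It is generated by the elementary forests $\underline i$, whose only internal node has children the leaves $i,i+1$; a *factorization* $F=i_1\cdots i_k$ is an expression $F=\underline{i_1}\cdots\underline{i_k}$. A node is *terminal* if both its children are leaves, $\operatorname{QDes}(F)$ is the set of labels of the left children of the terminal nodes of $F$, and for $i\in\operatorname{QDes}(F)$ the forest $F/i$ is obtained by deleting the corresponding terminal node (turning it into a leaf). For a finite $A\subset\mathbb N$ let $\overline A_1<\overline A_2<\cdots$ be the elements of $\mathbb N\setminus A$, $t_{i,A}=t_{\overline A_i}$, $\widehat{\mathbf t}_A=(t_{1,A},t_{2,A},\dots)$,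 and $i\star A=\{\overline A_i\}\cup A$; write $i_1\star\cdots\star i_k\star A=i_1\star(i_2\star(\cdots\star(i_k\star A)))$. For $f\in\mathbb Z[\mathbf t][\mathbf x]$ put $\operatorname{ev}_Af=f(\widehat{\mathbf t}_A;\mathbf t)$ and $$E_{i,A}f=\frac{f(x_1,\dots,x_i,t_{i,A},x_{i+1},\dots;\mathbf t)-f(x_1,\dots,x_{i-1},t_{i,A},x_i,\dots;\mathbf t)}{x_i-t_{i,A}}\in\mathbb Z[\mathbf t][\mathbf x].$$ For a word $i_1,\dots,i_k$ put $$[\operatorname{ev}\star E_{i_1}\star\cdots\star E_{i_k}]=\operatorname{ev}_{i_1\star\cdots\star i_k\star\emptyset}\;E_{i_1,\,i_2\star\cdots\star i_k\star\emptyset}\;E_{i_2,\,i_3\star\cdots\star i_k\star\emptyset}\cdots E_{i_k,\emptyset}:\ \mathbb Z[\mathbf t][\mathbf x]\to\mathbb Z[\mathbf t].$$ **Theorem.** 1. There is a unique family $(\mathfrak P_F)_{F\in\mathsf{Forest}}$ of homogeneous polynomials in $\mathbb Z[\mathbf t][\mathbf x]$ (homogeneous jointly in $\mathbf x$ and $\mathbf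 t$), the *double forest polynomials*, such that for all $F$ and $i$: $\mathfrak P_\emptyset(\mathbf t;\mathbf t)=1$ and $\mathfrak P_F(\mathbf t;\mathbf t)=0$ if $F\ne\emptyset$; and $E_{i,\emptyset}\mathfrak P_F=\mathfrak P_{F/i}(\mathbf x;\widehat{\mathbf t}_{\{i\}})$ if $i\in\operatorname{QDes}(F)$, while $E_{i,\emptyset}\mathfrak P_F=0$ otherwise. 2. For $F\in\mathsf{Forest}$ the operator $[\operatorname{ev}\star E_F]:=[\operatorname{ev}\star E_{i_1}\star\cdots\star E_{i_k}]$ does not depend on the choice of the factorization $F=i_1\cdots i_k$. 3. For every $f\in\mathbb Z[\mathbf t][\mathbf x]$ only finitely many of the polynomials $a_F=[\operatorname{ev}\star E_F]f\in\mathbb Z[\mathbf t]$, $F\in\mathsf{Forest}$, are nonzero, and $$f=\sum_{F\in\mathsf{Forest}}a_F\,\mathfrak P_F.$$ -/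

import Mathlib

/-! Conventions. The positive integers are shifted down by one: leaves, roots and variables are
indexed by `0, 1, 2, …`, so that `X i` is `x_{i+1}` and the coefficient variable `X i` is `t_{i+1}`. All
relations and definitions below are invariant under this shift. -/

namespace DoubleForest

/-- Plane binary trees: `.nil` is the trivial tree (a single leaf), and `.node () l r` is an internal
node with left child `l` and right child `r`. -/
abbrev PlaneTree : Type := BinaryTree Unit

/-- An indexed forest: a sequence of plane binary trees, all but finitely many of them trivial. -/
@[ext]
structure IndexedForest where
  tree : ℕ → PlaneTree
  finite : {k | tree k ≠ .nil}.Finite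

/-- The label of the leftmost leaf of the `k`-th tree of a sequence of trees, when all leaves are
labelled `0, 1, 2, …` from left to right. -/
def firstLeaf (G : ℕ → PlaneTree) (k : ℕ) : ℕ := ∑ j ∈ Finset.range k, (G j).numLeaves

theorem firstLeaf_succ (G : ℕ → PlaneTree) (k : ℕ) :
    firstLeaf G (k + 1) = firstLeaf G k + (G k).numLeaves := Finset.sum_range_succ _ _

theorem firstLeaf_strictMono (G : ℕ → PlaneTree) : StrictMono (firstLeaf G) :=
  strictMono_nat_of_lt_succ fun k => by
    rw [firstLeaf_succ]; exact Nat.lt_add_of_pos_right (G k).numLeaves_pos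

/-- For a tree whose leaves are labelled `s, s + 1, …` from left to right, attach the root of `G j` to
the leaf labelled `j`. -/
def graft (G : ℕ → PlaneTree) : PlaneTree → ℕ → PlaneTree
  | .nil, s => G s
  | .node _ l r, s => .node () (graft G l s) (graft G r (s + l.numLeaves))

theorem firstLeaf_graft (G : ℕ → PlaneTree) (T : PlaneTree) (s : ℕ) :
    firstLeaf G s + (graft G T s).numLeaves = firstLeaf G (s + T.numLeaves) := by
  induction T generalizing s with
  | nil => simp [graft, BinaryTree.numLeaves, firstLeaf_succ]
  | node _ l r hl hr =>
    simp only [graft, BinaryTree.numLeaves]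
    rw [← add_assoc, hl, hr, add_assoc]

theorem graft_graft (G H : ℕ → PlaneTree) (T : PlaneTree) (s : ℕ) :
    graft H (graft G T s) (firstLeaf G s) =
      graft (fun k => graft H (G k) (firstLeaf G k)) T s := by
  induction T generalizing s with
  | nil => rfl
  | node _ l r hl hr => simp only [graft, hl, firstLeaf_graft, hr]

theorem graft_nil (T : PlaneTree) (s : ℕ) : graft (fun _ => .nil) T s = T := by
  induction T generalizing s with
  | nil => rfl
  | node _ l r hl hr => simp [graft, hl, hr]

namespace IndexedForest

/-- The empty forest: all trees are trivial. -/
instance : One IndexedForest := ⟨⟨fun _ => .nil, by simp⟩⟩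

/-- The product `F * G`: for each `i`, the `i`-th leaf of `F` is attached to the `i`-th root of `G`. -/
instance : Mul IndexedForest where
  mul F G :=
    { tree := fun k => graft G.tree (F.tree k) (firstLeaf F.tree k)
      finite := by
        refine (F.finite.union (G.finite.preimage
          (f := firstLeaf F.tree) (firstLeaf_strictMono _).injective.injOn)).subset ?_
        intro k hk
        by_cases h : F.tree k = .nil
        · right
          simpa [h, graft] using hk
        · exact Or.inl h }

theorem one_tree : (1 : IndexedForest).tree = fun _ => .nil := rfl

theorem mul_tree (F G : IndexedForest) :
    (F * G).tree = fun k => graft G.tree (F.tree k) (firstLeaf F.tree k) := rfl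

theorem firstLeaf_mul (F G : IndexedForest) (k : ℕ) :
    firstLeaf (F * G).tree k = firstLeaf G.tree (firstLeaf F.tree k) := by
  induction k with
  | zero => simp [firstLeaf]
  | succ k ih =>
    rw [firstLeaf_succ, ih, mul_tree]
    dsimp only
    rw [firstLeaf_graft, ← firstLeaf_succ]

/-- Indexed forests form a monoid. -/
instance : Monoid IndexedForest where
  mul_assoc F G H := by
    ext1; funext k
    rw [mul_tree (F * G), mul_tree F (G * H)]
    dsimp only
    rw [firstLeaf_mul, mul_tree, mul_tree]
    exact graft_graft _ _ _ _
  one_mul F := by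
    ext1; funext k
    rw [mul_tree, one_tree]
    simp [graft, firstLeaf, BinaryTree.numLeaves]
  mul_one F := by
    ext1; funext k
    rw [mul_tree, one_tree]
    exact graft_nil _ _

/-- The `i`-th elementary forest: its only internal node has the leaf `i` as left child
and the leaf `i + 1` as right child. -/
def elementary (i : ℕ) : IndexedForest where
  tree k := if k = i then .node () .nil .nil else .nil
  finite := (Set.finite_singleton i).subset fun k hk => by
    by_contra h
    have h' : k ≠ i := h
    simp [h'] at hk

/-- The words `i₁, …, i_k` that are factorizations `F = i₁ ⋯ i_k` of `F` into elementary forests. -/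
def trimmingWords (F : IndexedForest) : Set (List ℕ) :=
  {w | (w.map elementary).prod = F}

theorem elementary_mul (i : ℕ) (G : IndexedForest) :
    (elementary i * G).tree = fun k => if k < i then G.tree k else
      if k = i then .node () (G.tree i) (G.tree (i + 1)) else G.tree (k + 1) := by
  have key : ∀ k, firstLeaf (elementary i).tree k = if k ≤ i then k else k + 1 := by
    intro k
    induction k with
    | zero => simp [firstLeaf]
    | succ k ih =>
      rw [firstLeaf_succ, ih]
      by_cases h : k = i
      · simp [elementary, h, BinaryTree.numLeaves]
      · simp only [elementary, h, if_false, BinaryTree.numLeaves]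
        split_ifs <;> omega
  funext k
  rw [mul_tree]
  dsimp only
  rw [key]
  rcases lt_trichotomy k i with h | h | h
  · simp [elementary, h, h.ne, h.le, graft]
  · subst h
    simp [elementary, graft, BinaryTree.numLeaves]
  · simp [elementary, h.ne', h.not_ge, h.not_gt, graft]

/-- The elementary forests generate the monoid of indexed forests. -/
theorem trimmingWords_nonempty (F : IndexedForest) : F.trimmingWords.Nonempty := by
  -- claim for a forest made of `k` trivial trees, the trees of a list `L`, and trivial trees
  have main : ∀ (n k : ℕ) (L : List PlaneTree),
      (L.map fun T : PlaneTree => 2 * T.numNodes + 1).sum ≤ n →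
      ∀ F : IndexedForest, (∀ j < k, F.tree j = .nil) →
        (∀ j, F.tree (k + j) = L.getD j .nil) → F.trimmingWords.Nonempty := by
    intro n
    induction n with
    | zero =>
      intro k L hL F h1 h2
      have hnil : L = [] := by
        cases L with
        | nil => rfl
        | cons T L => simp at hL
      refine ⟨[], ?_⟩
      have : F = 1 := by
        ext1; funext j
        rw [one_tree]
        rcases lt_or_ge j k with h | h
        · exact h1 j h
        · obtain ⟨m, rfl⟩ := Nat.exists_eq_add_of_le h
          rw [h2, hnil]; rfl
      simp [trimmingWords, this]
    | succ n ih =>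
      intro k L hL F h1 h2
      match L, hL, h2 with
      | [], _, h2 => exact ih k [] (by simp) F h1 h2
      | .nil :: L, hL, h2 =>
        refine ih (k + 1) L ?_ F ?_ ?_
        · simp only [List.map_cons, List.sum_cons] at hL; omega
        · intro j hj
          rcases Nat.lt_succ_iff_lt_or_eq.1 hj with h | rfl
          · exact h1 j h
          · simpa using h2 0
        · intro j
          have := h2 (j + 1)
          rw [show k + 1 + j = k + (j + 1) by ring, this]; rfl
      | .node u l r :: L, hL, h2 =>
        let F' : IndexedForest :=
          { tree := fun j => if j < k then .nil else (l :: r :: L).getD (j - k) .nil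
            finite := (Set.finite_lt_nat (k + (l :: r :: L).length)).subset fun j hj => by
              by_contra hcon
              have h3 : ¬ j < k + (l :: r :: L).length := hcon
              apply hj
              show (if j < k then _ else _) = _
              rw [if_neg (by omega)]
              exact List.getD_eq_default _ _ (by omega) }
        have hF : F = elementary k * F' := by
          ext1
          rw [elementary_mul]
          funext j
          rcases lt_trichotomy j k with h | h | h
          · simp [h, h1, F']
          · subst h
            have := h2 0
            simp only [add_zero, List.getD_cons_zero] at this
            simp [F', this]
          · obtain ⟨m, rfl⟩ := Nat.exists_eq_add_of_lt h
            have h4 := h2 (m + 1)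
            rw [add_assoc, h4]
            simp [F', show k + (m + 1) + 1 - k = m + 2 by omega]
            omega
        obtain ⟨w, hw⟩ := ih k (l :: r :: L) (by
          simp only [List.map_cons, List.sum_cons, BinaryTree.numNodes] at hL ⊢
          omega) F' (fun j hj => by simp [F', hj]) (fun j => by simp [F'])
        refine ⟨k :: w, ?_⟩
        have hw' : (w.map elementary).prod = F' := hw
        simp [trimmingWords, hw', hF]
  obtain ⟨N, hN⟩ := F.finite.bddAbove
  refine main _ 0 ((List.range (N + 1)).map F.tree) le_rfl F (by simp) fun j => ?_
  rw [zero_add]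
  rcases lt_or_ge j (N + 1) with h | h
  · simp [h]
  · rw [List.getD_eq_default _ _ (by simpa using h)]
    by_contra hj
    have := hN hj
    omega

end IndexedForest

/-- For a tree whose leaves are labelled `s, s + 1, …`: the labels of the terminal nodes (the internal
nodes both of whose children are leaves), the label of a terminal node being that of its left child,
i.e. of the leaf reached from it by going down left edges. -/
def terminalLabels : PlaneTree → ℕ → Set ℕ
  | .nil, _ => ∅
  | .node _ l r, s => {i | l = .nil ∧ r = .nil ∧ s = i} ∪
      (terminalLabels l s ∪ terminalLabels r (s + l.numLeaves))

/-- For a tree whose leaves are labelled `s, s + 1, …`: delete the terminal node with label `i` (so that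
it becomes a leaf), if there is one. -/
def deleteTerminal (i : ℕ) : PlaneTree → ℕ → PlaneTree
  | .nil, _ => .nil
  | .node _ l r, s =>
      if l = .nil ∧ r = .nil ∧ s = i then .nil
      else .node () (deleteTerminal i l s) (deleteTerminal i r (s + l.numLeaves))

namespace IndexedForest

/-- The set `QDes(F)` of labels of the terminal nodes of `F`. -/
def qDes (F : IndexedForest) : Set ℕ :=
  {i | ∃ k, i ∈ terminalLabels (F.tree k) (firstLeaf F.tree k)}

/-- The trimmed forest `F / i`: the terminal node of `F` with label `i` is deleted. -/
def trim (F : IndexedForest) (i : ℕ) : IndexedForest where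
  tree k := deleteTerminal i (F.tree k) (firstLeaf F.tree k)
  finite := F.finite.subset fun k hk h => hk (by simp [h, deleteTerminal])

end IndexedForest

open MvPolynomial

/-- The ring `ℤ[t]`. -/
abbrev CoeffRing : Type := MvPolynomial ℕ ℤ

/-- The ring `ℤ[t][x]`. -/
abbrev PolyRing : Type := MvPolynomial ℕ CoeffRing

/-- `complNth A i` is the `i`-th element of the complement of the finite set `A`, in increasing order. -/
noncomputable def complNth (A : Finset ℕ) (i : ℕ) : ℕ := Nat.nth (fun n => n ∉ A) i

/-- The variable `t_{i,A}`, the `i`-th term of the sequence `t̂_A` of those `t_j` with `j ∉ A`. -/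
noncomputable def tHat (A : Finset ℕ) (i : ℕ) : CoeffRing := X (complNth A i)

/-- `ev_A f = f(t̂_A; t)`. -/
noncomputable def evA (A : Finset ℕ) : PolyRing →ₐ[CoeffRing] CoeffRing := aeval (tHat A)

/-- The reindexing `f(x; t) ↦ f(x; t̂_A)` of the equivariant variables. -/
noncomputable def substT (A : Finset ℕ) : PolyRing →+* PolyRing :=
  MvPolynomial.map (rename (complNth A) : CoeffRing →ₐ[ℤ] CoeffRing).toRingHom

/-- The equivariant Bergeron–Sottile map
`R⁻_{i,A} f = f(x_1, …, x_{i-1}, t_{i,A}, x_i, x_{i+1}, …; t)`. -/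
noncomputable def rMinus (i : ℕ) (A : Finset ℕ) : PolyRing →ₐ[CoeffRing] PolyRing :=
  aeval fun j => if j < i then X j else if j = i then C (tHat A i) else X (j - 1)

/-- The equivariant Bergeron–Sottile map
`R⁺_{i,A} f = f(x_1, …, x_{i-1}, x_i, t_{i,A}, x_{i+1}, …; t)`. -/
noncomputable def rPlus (i : ℕ) (A : Finset ℕ) : PolyRing →ₐ[CoeffRing] PolyRing :=
  aeval fun j => if j < i + 1 then X j else if j = i + 1 then C (tHat A i) else X (j - 1)

theorem dvd_rPlus_sub_rMinus (i : ℕ) (A : Finset ℕ) (f : PolyRing) :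
    (X i - C (tHat A i) : PolyRing) ∣ rPlus i A f - rMinus i A f := by
  induction f using MvPolynomial.induction_on with
  | C a => simp [rPlus, rMinus]
  | add p q hp hq =>
    rw [map_add, map_add, add_sub_add_comm]
    exact dvd_add hp hq
  | mul_X p j hp =>
    have hX : (X i - C (tHat A i) : PolyRing) ∣ rPlus i A (X j) - rMinus i A (X j) := by
      simp only [rPlus, rMinus, aeval_X]
      rcases lt_trichotomy j i with h | rfl | h
      · simp [h, h.trans (Nat.lt_succ_self i)]
      · simp
      · rcases Nat.eq_or_lt_of_le h with rfl | h2
        · simp only [lt_irrefl, if_false, if_true, Nat.succ_eq_add_one, Nat.add_sub_cancel]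
          rw [if_neg (by omega), if_neg (by omega)]
          exact ⟨-1, by ring⟩
        · rw [if_neg (by omega), if_neg (by omega), if_neg (by omega), if_neg (by omega)]
          simp
    rw [map_mul, map_mul, show rPlus i A p * rPlus i A (X j) - rMinus i A p * rMinus i A (X j) =
      rPlus i A p * (rPlus i A (X j) - rMinus i A (X j)) +
        (rPlus i A p - rMinus i A p) * rMinus i A (X j) by ring]
    exact dvd_add (hX.mul_left _) (hp.mul_right _)

/-- The equivariant trimming operation `E_{i,A} f = (R⁺_{i,A} f - R⁻_{i,A} f) / (x_i - t_{i,A})`;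
the polynomial division is exact. -/
noncomputable def trimOp (i : ℕ) (A : Finset ℕ) (f : PolyRing) : PolyRing :=
  (dvd_rPlus_sub_rMinus i A f).choose

theorem mul_trimOp (i : ℕ) (A : Finset ℕ) (f : PolyRing) :
    (X i - C (tHat A i)) * trimOp i A f = rPlus i A f - rMinus i A f :=
  (dvd_rPlus_sub_rMinus i A f).choose_spec.symm

/-- The product `B ⋆ A = {the i-th element of the complement of A | i ∈ B} ∪ A` of finite sets. -/
noncomputable def starSet (B A : Finset ℕ) : Finset ℕ := B.image (complNth A) ∪ A

/-- For `w = i₁, …, i_k`: the finite set `i₁ ⋆ ⋯ ⋆ i_k ⋆ A`. -/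
noncomputable def starWeight (w : List ℕ) (A : Finset ℕ) : Finset ℕ :=
  w.foldr (fun i B => starSet {i} B) A

/-- For `w = i₁, …, i_k`: the `⋆`-composition
`[E_{i₁} ⋆ ⋯ ⋆ E_{i_k}]_A = E_{i₁, i₂ ⋆ ⋯ ⋆ i_k ⋆ A} E_{i₂, i₃ ⋆ ⋯ ⋆ i_k ⋆ A} ⋯ E_{i_k, A}`. -/
noncomputable def starComp (A : Finset ℕ) : List ℕ → PolyRing → PolyRing
  | [], f => f
  | i :: w, f => trimOp i (starWeight w A) (starComp A w f)

/-- For `w = i₁, …, i_k`: the operation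
`[ev ⋆ E_{i₁} ⋆ ⋯ ⋆ E_{i_k}]_A = ev_{i₁ ⋆ ⋯ ⋆ i_k ⋆ A} [E_{i₁} ⋆ ⋯ ⋆ E_{i_k}]_A`. -/
noncomputable def evStar (A : Finset ℕ) (w : List ℕ) (f : PolyRing) : CoeffRing :=
  evA (starWeight w A) (starComp A w f)

/-- The extraction operator `[ev ⋆ E_F] = [ev ⋆ E_{i₁} ⋆ ⋯ ⋆ E_{i_k}]` for a factorization
`F = i₁ ⋯ i_k` of `F`. -/
noncomputable def evStarForest (F : IndexedForest) (f : PolyRing) : CoeffRing :=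
  evStar ∅ F.trimmingWords_nonempty.choose f

/-- A polynomial in `ℤ[t][x]` is homogeneous if it is homogeneous as a polynomial in all the
variables `x` and `t` jointly. -/
def IsHomog (f : PolyRing) : Prop :=
  ∃ d : ℕ, ((sumAlgEquiv ℤ ℕ ℕ).symm f).IsHomogeneous d

open Classical in
/-- The properties that characterize the family of double forest polynomials: they are
homogeneous, `𝔓_F(t; t)` is `1` if `F` is empty and `0` otherwise, and `E_i 𝔓_F` is `𝔓_{F/i}(x; t̂_i)` if
`i ∈ QDes(F)` and `0` otherwise. -/
structure IsDoubleForestFamily (P : IndexedForest → PolyRing) : Prop where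
  homogeneous : ∀ F, IsHomog (P F)
  normalization : ∀ F, evA ∅ (P F) = if F = 1 then 1 else 0
  recursion : ∀ F i, trimOp i ∅ (P F) = if i ∈ F.qDes then substT {i} (P (F.trim i)) else 0

/-- The double forest polynomials `𝔓_F`: the family with the characterizing properties. (It is part
of the claim below that there is one and only one such family.) -/
noncomputable def doubleForest : IndexedForest → PolyRing :=
  Classical.epsilon IsDoubleForestFamily

end DoubleForest

open DoubleForest

/-!
The maps `(f, A) ↦ (E_{i,A} f, i ⋆ A)` satisfy the relations `i · j = j · (i + 1)`, `j < i`, which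
present the forest monoid; hence `[ev ⋆ E_{i₁} ⋆ ⋯ ⋆ E_{i_k}]` depends only on the forest
`i₁ ⋯ i_k`. Every `E_{i,A}` lowers the joint degree by one, and a polynomial killed by `ev_A` and by
all `E_{i,A}` is zero, so by induction on the degree a polynomial is determined by its values under
the operators `[ev ⋆ E_F]`. The properties required of `𝔓_F` say that `𝔓_F` is dual to `[ev ⋆ E_F]`;
this gives uniqueness, and the expansion once these operators are applied to both sides.

For existence, one inducts on the number of nodes. A family `g_i` that satisfies the relations
between the `E_{i,A} f` and vanishes for large `i` is of the form `E_{i,A} f`. The polynomials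
`𝔓_{F/i}(x; t̂_i)` for `i ∈ QDes(F)`, extended by zero, satisfy these relations: both sides of each
take the same values under all evaluated compositions of trimming operations.
-/

namespace DoubleForest

open IndexedForest MvPolynomial

theorem firstLeaf_elementary (j k : ℕ) :
    firstLeaf (elementary j).tree k = if k ≤ j then k else k + 1 := by
  induction k with
  | zero => simp [firstLeaf]
  | succ k ih =>
    rw [firstLeaf_succ, ih]
    by_cases h : k = j
    · simp [elementary, h, BinaryTree.numLeaves]
    · simp only [elementary, h, if_false, BinaryTree.numLeaves]
      split_ifs <;> omega

theorem terminalLabels_subset_Ico (T : PlaneTree) (s : ℕ) :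
    terminalLabels T s ⊆ Set.Ico s (s + T.numLeaves) := by
  induction T generalizing s with
  | nil => exact Set.empty_subset _
  | node _ l r hl hr =>
    have hlpos := l.numLeaves_pos
    have hrpos := r.numLeaves_pos
    simp only [BinaryTree.numLeaves]
    rintro j (⟨-, -, rfl⟩ | hj | hj)
    · exact ⟨le_rfl, by omega⟩
    · exact Set.Ico_subset_Ico_right (by omega) (hl s hj)
    · exact Set.Ico_subset_Ico (by omega) (by omega) (hr _ hj)

theorem graft_elementary_deleteTerminal {j s s' : ℕ} {T : PlaneTree}
    (hs : firstLeaf (elementary j).tree s' = s)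
    (hj : j ∈ Set.Ico s (s + T.numLeaves) → j ∈ terminalLabels T s) :
    graft (elementary j).tree (deleteTerminal j T s) s' = T := by
  induction T generalizing s s' with
  | nil =>
    have hne : s' ≠ j := by
      rintro rfl
      rw [firstLeaf_elementary, if_pos le_rfl] at hs
      exact hj (by simp [hs, BinaryTree.numLeaves])
    simp [deleteTerminal, graft, elementary, hne]
  | node _ l r hl hr =>
    rw [deleteTerminal]
    split_ifs with hroot
    · obtain ⟨rfl, rfl, rfl⟩ := hroot
      have hs' : s' = s := by rw [firstLeaf_elementary] at hs; split_ifs at hs <;> omega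
      simp [hs', graft, elementary]
    · simp only [terminalLabels, Set.mem_union, Set.mem_ofPred_eq, hroot, false_or,
        BinaryTree.numLeaves, Set.mem_Ico] at hj
      have hleft : graft (elementary j).tree (deleteTerminal j l s) s' = l := hl hs fun h =>
        (hj ⟨h.1, by linarith [h.2]⟩).resolve_right fun h' =>
          h.2.not_ge (terminalLabels_subset_Ico _ _ h').1
      have hstart : firstLeaf (elementary j).tree (s' + (deleteTerminal j l s).numLeaves) =
          s + l.numLeaves := by
        rw [← firstLeaf_graft, hleft, hs]
      have hright := hr hstart fun h =>
        (hj ⟨by linarith [h.1], by linarith [h.2]⟩).resolve_left fun h' =>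
          h.1.not_gt (terminalLabels_subset_Ico _ _ h').2
      rw [graft, hleft, hright]

theorem mem_terminalLabels_graft_elementary {j s : ℕ} {T : PlaneTree}
    (hj : j ∈ Set.Ico s (s + T.numLeaves)) :
    j ∈ terminalLabels (graft (elementary j).tree T s) (firstLeaf (elementary j).tree s) := by
  induction T generalizing s with
  | nil =>
    obtain rfl : s = j := by simp only [BinaryTree.numLeaves, Set.mem_Ico] at hj; omega
    rw [firstLeaf_elementary, if_pos le_rfl]
    simp [graft, elementary, terminalLabels]
  | node _ l r hl hr =>
    simp only [BinaryTree.numLeaves, Set.mem_Ico] at hj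
    simp only [graft, terminalLabels, firstLeaf_graft]
    by_cases h : j < s + l.numLeaves
    · exact Or.inr (Or.inl (hl ⟨hj.1, h⟩))
    · exact Or.inr (Or.inr (hr ⟨not_lt.1 h, by linarith [hj.2]⟩))

theorem deleteTerminal_graft_elementary (j : ℕ) (T : PlaneTree) (s : ℕ) :
    deleteTerminal j (graft (elementary j).tree T s) (firstLeaf (elementary j).tree s) = T := by
  induction T generalizing s with
  | nil =>
    obtain rfl | h := eq_or_ne s j
    · rw [firstLeaf_elementary, if_pos le_rfl]
      simp [graft, elementary, deleteTerminal]
    · simp [graft, elementary, h, deleteTerminal]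
  | node _ l r hl hr =>
    have hroot : ¬(graft (elementary j).tree l s = .nil ∧
        graft (elementary j).tree r (s + l.numLeaves) = .nil ∧
        firstLeaf (elementary j).tree s = j) := by
      rintro ⟨hnil, -, hs⟩
      have hsj : s = j := by rw [firstLeaf_elementary] at hs; split_ifs at hs <;> omega
      cases l <;> simp [graft, elementary, hsj] at hnil
    simp only [graft, deleteTerminal, firstLeaf_graft, hl, hr, hroot, if_false]

theorem exists_mem_Ico_firstLeaf (G : ℕ → PlaneTree) (j : ℕ) :
    ∃ k, j ∈ Set.Ico (firstLeaf G k) (firstLeaf G (k + 1)) := by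
  have hcover := iUnion_Ico_map_succ_eq_Ici (f := firstLeaf G)
    (fun n => (firstLeaf_strictMono G).monotone (Nat.zero_le n))
    (not_bddAbove_iff.2 fun n => ⟨_, ⟨n + 1, rfl⟩, (firstLeaf_strictMono G).le_apply⟩)
  have hj : j ∈ Set.Ici (firstLeaf G ⊥) := Nat.zero_le j
  rwa [← hcover, Set.mem_iUnion] at hj

theorem eq_of_mem_Ico_firstLeaf {G : ℕ → PlaneTree} {j k m : ℕ}
    (hk : j ∈ Set.Ico (firstLeaf G k) (firstLeaf G (k + 1)))
    (hm : j ∈ Set.Ico (firstLeaf G m) (firstLeaf G (m + 1))) : k = m :=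
  le_antisymm
    (Nat.lt_succ_iff.1 ((firstLeaf_strictMono G).lt_iff_lt.1 (hk.1.trans_lt hm.2)))
    (Nat.lt_succ_iff.1 ((firstLeaf_strictMono G).lt_iff_lt.1 (hm.1.trans_lt hk.2)))

namespace IndexedForest

theorem qDes_one : (1 : IndexedForest).qDes = ∅ := by
  simp [qDes, terminalLabels]

theorem bddAbove_qDes (F : IndexedForest) : BddAbove F.qDes := by
  obtain ⟨N, hN⟩ := F.finite.bddAbove
  refine ⟨firstLeaf F.tree (N + 1), ?_⟩
  rintro j ⟨k, hk⟩
  have hkN : k ≤ N := hN fun h => by simp [h, terminalLabels] at hk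
  calc j ≤ firstLeaf F.tree (k + 1) := by
        rw [firstLeaf_succ]; exact (terminalLabels_subset_Ico _ _ hk).2.le
    _ ≤ firstLeaf F.tree (N + 1) := (firstLeaf_strictMono _).monotone (by omega)

theorem mem_qDes_mul_elementary (G : IndexedForest) (j : ℕ) : j ∈ (G * elementary j).qDes := by
  obtain ⟨k, hk⟩ := exists_mem_Ico_firstLeaf G.tree j
  refine ⟨k, ?_⟩
  rw [firstLeaf_mul]
  exact mem_terminalLabels_graft_elementary (by rwa [← firstLeaf_succ])

theorem trim_mul_elementary (G : IndexedForest) (j : ℕ) : (G * elementary j).trim j = G := by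
  ext1
  funext k
  simp only [trim, firstLeaf_mul]
  exact deleteTerminal_graft_elementary _ _ _

theorem mul_elementary_trim {F : IndexedForest} {j : ℕ} (hj : j ∈ F.qDes) :
    F.trim j * elementary j = F := by
  obtain ⟨k, hk⟩ := hj
  have hmem (m : ℕ) (hm : j ∈ Set.Ico (firstLeaf F.tree m)
      (firstLeaf F.tree m + (F.tree m).numLeaves)) :
      j ∈ terminalLabels (F.tree m) (firstLeaf F.tree m) := by
    have hk' := terminalLabels_subset_Ico _ _ hk
    rw [← firstLeaf_succ] at hm hk'
    exact eq_of_mem_Ico_firstLeaf hk' hm ▸ hk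
  have hfirst (m : ℕ) : firstLeaf (elementary j).tree (firstLeaf (F.trim j).tree m) =
      firstLeaf F.tree m := by
    induction m with
    | zero => simp [firstLeaf]
    | succ m ih =>
      rw [firstLeaf_succ, firstLeaf_succ, ← firstLeaf_graft, ih, trim]
      exact congrArg (_ + BinaryTree.numLeaves ·) (graft_elementary_deleteTerminal ih (hmem m))
  ext1
  funext m
  exact graft_elementary_deleteTerminal (hfirst m) (hmem m)

theorem mul_elementary_eq_iff {F G : IndexedForest} {j : ℕ} :
    G * elementary j = F ↔ j ∈ F.qDes ∧ F.trim j = G := by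
  constructor
  · rintro rfl
    exact ⟨mem_qDes_mul_elementary G j, trim_mul_elementary G j⟩
  · rintro ⟨h, rfl⟩
    exact mul_elementary_trim h

theorem elementary_mul_elementary {i j : ℕ} (h : j < i) :
    elementary i * elementary j = elementary j * elementary (i + 1) := by
  ext1
  funext k
  rw [elementary_mul, elementary_mul]
  simp only [elementary]
  split_ifs <;> first | rfl | omega

theorem isLeftRegular_elementary (i : ℕ) : IsLeftRegular (elementary i) := by
  intro G H h
  have htree (k : ℕ) := congrFun (congrArg tree h) k
  simp only [elementary_mul] at htree
  have hi := htree i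
  simp only [lt_irrefl, if_false, if_true, BinaryTree.node.injEq, true_and] at hi
  ext1
  funext k
  obtain hk | rfl | hk := lt_trichotomy k i
  · simpa [hk] using htree k
  · exact hi.1
  · obtain rfl | hk := (Nat.succ_le_of_lt hk).eq_or_lt
    · exact hi.2
    · have hik : i < k - 1 := Nat.lt_sub_of_add_lt hk
      simpa [hik.not_gt, hik.ne', show k - 1 + 1 = k by omega] using htree (k - 1)

end IndexedForest

section Presentation

variable {M : Type*} [Monoid M] {a : ℕ → M}

/-- The relations move the letter that creates the root of the `m`-th tree to the front. -/
theorem exists_prod_map_eq_mul (ha : ∀ i j, j < i → a i * a j = a j * a (i + 1)) {w : List ℕ}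
    {m : ℕ} (hm : (w.map elementary).prod.tree m ≠ .nil) :
    ∃ u : List ℕ, (w.map elementary).prod = elementary m * (u.map elementary).prod ∧
      (w.map a).prod = a m * (u.map a).prod := by
  induction w generalizing m with
  | nil => simp [one_tree] at hm
  | cons i w ih =>
    simp only [List.map_cons, List.prod_cons, elementary_mul] at hm ⊢
    obtain hmi | rfl | him := lt_trichotomy m i
    · obtain ⟨u, hu, hua⟩ := ih (m := m) (by simpa [hmi] using hm)
      refine ⟨(i + 1) :: u, ?_, ?_⟩
      · rw [hu, ← mul_assoc, elementary_mul_elementary hmi, mul_assoc]; simp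
      · rw [hua, ← mul_assoc, ha i m hmi, mul_assoc]; simp
    · exact ⟨w, rfl, rfl⟩
    · obtain ⟨u, hu, hua⟩ := ih (m := m + 1) (by simpa [him.not_gt, him.ne'] using hm)
      refine ⟨i :: u, ?_, ?_⟩
      · rw [hu, ← mul_assoc, ← elementary_mul_elementary him, mul_assoc]; simp
      · rw [hua, ← mul_assoc, ← ha m i him, mul_assoc]; simp

theorem prod_map_eq_of_prod_elementary_eq (ha : ∀ i j, j < i → a i * a j = a j * a (i + 1))
    {v w : List ℕ} (h : (v.map elementary).prod = (w.map elementary).prod) :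
    (v.map a).prod = (w.map a).prod := by
  induction v generalizing w with
  | nil =>
    cases w with
    | nil => rfl
    | cons i w =>
      have hi := congrFun (congrArg tree h) i
      simp [one_tree, elementary_mul] at hi
  | cons i v ih =>
    obtain ⟨u, hu, hua⟩ := exists_prod_map_eq_mul ha (w := w) (m := i)
      (by simp [← h, elementary_mul])
    have huv : (v.map elementary).prod = (u.map elementary).prod :=
      isLeftRegular_elementary i (by simpa [hu] using h)
    rw [hua, List.map_cons, List.prod_cons, ih huv]

end Presentation

namespace IndexedForest

/-- The number of internal nodes of a forest, encoded as the length of a factorization into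
elementary forests; by `size_prod_elementary` it does not depend on the factorization. -/
noncomputable def size (F : IndexedForest) : ℕ := F.trimmingWords_nonempty.choose.length

theorem size_prod_elementary (w : List ℕ) : (w.map elementary).prod.size = w.length := by
  have hprod := prod_map_eq_of_prod_elementary_eq
    (a := fun _ => Multiplicative.ofAdd 1) (fun _ _ _ => rfl)
    (w.map elementary).prod.trimmingWords_nonempty.choose_spec
  simpa [size] using congrArg Multiplicative.toAdd hprod

theorem size_mul_elementary (F : IndexedForest) (i : ℕ) :
    (F * elementary i).size = F.size + 1 := by
  obtain ⟨w, rfl⟩ := F.trimmingWords_nonempty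
  simpa [size_prod_elementary] using size_prod_elementary (w ++ [i])

theorem size_trim_add_one {F : IndexedForest} {i : ℕ} (hi : i ∈ F.qDes) :
    (F.trim i).size + 1 = F.size := by
  rw [← size_mul_elementary, mul_elementary_trim hi]

theorem size_eq_zero_iff {F : IndexedForest} : F.size = 0 ↔ F = 1 := by
  obtain ⟨w, rfl⟩ := F.trimmingWords_nonempty
  rw [size_prod_elementary, List.length_eq_zero_iff]
  constructor
  · rintro rfl
    rfl
  · intro h
    rw [← List.length_eq_zero_iff, ← size_prod_elementary, h]
    exact size_prod_elementary []

end IndexedForest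

section Complement

theorem complNth_strictMono (A : Finset ℕ) : StrictMono (complNth A) :=
  Nat.nth_strictMono A.finite_toSet.infinite_compl

theorem range_complNth (A : Finset ℕ) : Set.range (complNth A) = (A : Set ℕ)ᶜ :=
  Nat.range_nth_of_infinite A.finite_toSet.infinite_compl

theorem complNth_eq_of_range {A : Finset ℕ} {φ : ℕ → ℕ} (hφ : StrictMono φ)
    (hr : Set.range φ = (A : Set ℕ)ᶜ) : complNth A = φ :=
  ((complNth_strictMono A).range_inj hφ).1 ((range_complNth A).trans hr.symm)

theorem complNth_injective : Function.Injective complNth := fun A B h => by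
  simpa [h, range_complNth, eq_comm] using range_complNth A

@[simp]
theorem complNth_empty : complNth ∅ = id :=
  complNth_eq_of_range strictMono_id (by simp)

theorem complNth_singleton (i : ℕ) : complNth {i} = fun k => if k < i then k else k + 1 := by
  apply complNth_eq_of_range
  · intro a b hab
    dsimp only
    split_ifs <;> omega
  · ext n
    simp only [Set.mem_range, Finset.coe_singleton, Set.mem_compl_iff, Set.mem_singleton_iff]
    constructor
    · rintro ⟨k, rfl⟩
      split_ifs <;> omega
    · intro hn
      obtain hn | hn := lt_or_gt_of_ne hn
      · exact ⟨n, if_pos hn⟩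
      · exact ⟨n - 1, by rw [if_neg (by omega)]; omega⟩

theorem complNth_starSet (B A : Finset ℕ) :
    complNth (starSet B A) = complNth A ∘ complNth B := by
  apply complNth_eq_of_range ((complNth_strictMono A).comp (complNth_strictMono B))
  rw [Set.range_comp, range_complNth,
    Set.image_compl_eq_range_sdiff_image (complNth_strictMono A).injective, range_complNth, starSet,
    Finset.coe_union, Finset.coe_image, Set.compl_union, Set.sdiff_eq, Set.inter_comm]

@[simp]
theorem starSet_empty (B : Finset ℕ) : starSet B ∅ = B :=
  complNth_injective (by simp [complNth_starSet])

@[simp]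
theorem empty_starSet (A : Finset ℕ) : starSet ∅ A = A :=
  complNth_injective (by simp [complNth_starSet])

theorem starSet_assoc (C B A : Finset ℕ) : starSet (starSet C B) A = starSet C (starSet B A) :=
  complNth_injective (by simp only [complNth_starSet, Function.comp_assoc])

theorem starSet_singleton_comm {i j : ℕ} (h : j < i) (A : Finset ℕ) :
    starSet {i} (starSet {j} A) = starSet {j} (starSet {i + 1} A) := by
  apply complNth_injective
  simp only [complNth_starSet, complNth_singleton, Function.comp_assoc]
  congr 1
  funext k
  simp only [Function.comp_apply]
  split_ifs <;> omega

theorem tHat_starSet_of_lt {i j : ℕ} (h : i < j) (A : Finset ℕ) :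
    tHat (starSet {j} A) i = tHat A i := by
  simp [tHat, complNth_starSet, complNth_singleton, h]

theorem tHat_starSet_of_le {i j : ℕ} (h : j ≤ i) (A : Finset ℕ) :
    tHat (starSet {j} A) i = tHat A (i + 1) := by
  simp [tHat, complNth_starSet, complNth_singleton, h.not_gt]

theorem rename_complNth_tHat (A B : Finset ℕ) (i : ℕ) :
    rename (complNth A) (tHat B i) = tHat (starSet B A) i := by
  simp [tHat, complNth_starSet]

end Complement

section InsertVar

variable {R S : Type*} [CommSemiring R] [CommSemiring S]

/-- The substitution `f ↦ f(x_0, …, x_{k-1}, a, x_k, x_{k+1}, …)` inserting the constant `a` at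
position `k`. The maps `R⁻_{i,A}` and `R⁺_{i,A}` insert `t_{i,A}` at the positions `i`
and `i + 1`. -/
noncomputable def insertVar (k : ℕ) (a : R) : MvPolynomial ℕ R →ₐ[R] MvPolynomial ℕ R :=
  aeval fun j => if j < k then X j else if j = k then C a else X (j - 1)

theorem insertVar_X (k : ℕ) (a : R) (j : ℕ) :
    insertVar k a (X j) = if j < k then X j else if j = k then C a else X (j - 1) :=
  aeval_X _ j

theorem insertVar_C (k : ℕ) (a b : R) : insertVar k a (C b) = C b := algHom_C _ b

theorem insertVar_comm {k l : ℕ} (h : k ≤ l) (a b : R) (f : MvPolynomial ℕ R) :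
    insertVar l b (insertVar k a f) = insertVar k a (insertVar (l + 1) b f) := by
  suffices (insertVar l b).comp (insertVar k a) =
      (insertVar k a).comp (insertVar (l + 1) b) from DFunLike.congr_fun this f
  refine MvPolynomial.algHom_ext fun j => ?_
  grind [AlgHom.comp_apply, insertVar_X, insertVar_C]

theorem map_insertVar (φ : R →+* S) (k : ℕ) (a : R) (f : MvPolynomial ℕ R) :
    map φ (insertVar k a f) = insertVar k (φ a) (map φ f) := by
  induction f using MvPolynomial.induction_on with
  | C b => simp only [insertVar_C, map_C]
  | add p q hp hq => simp only [map_add, hp, hq]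
  | mul_X p j hp =>
    simp only [map_mul, hp, insertVar_X, map_X]
    split_ifs <;> simp only [map_X, map_C]

theorem insertVar_of_mem_supported {n k : ℕ} (h : n ≤ k) (a : R) {f : MvPolynomial ℕ R}
    (hf : f ∈ supported R (Set.Iio n)) : insertVar k a f = f := by
  refine AlgHom.adjoin_le_equalizer (insertVar k a) (AlgHom.id R _) ?_ hf
  rintro _ ⟨j, hj, rfl⟩
  have hjk : j < k := lt_of_lt_of_le hj h
  simp [insertVar_X, hjk]

theorem insertVar_mem_supported {k : ℕ} (a : R) {f : MvPolynomial ℕ R}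
    (hf : f ∈ supported R (Set.Iio (k + 1))) : insertVar k a f ∈ supported R (Set.Iio k) := by
  suffices supported R (Set.Iio (k + 1)) ≤ (supported R (Set.Iio k)).comap (insertVar k a) from
    this hf
  refine Algebra.adjoin_le ?_
  rintro _ ⟨j, hj, rfl⟩
  have hj' : j < k + 1 := hj
  change insertVar k a (X j) ∈ supported R (Set.Iio k)
  rw [insertVar_X]
  split_ifs with hlt heq
  · exact Algebra.subset_adjoin ⟨j, hlt, rfl⟩
  · exact Subalgebra.algebraMap_mem _ a
  · omega

theorem exists_mem_supported_Iio (f : MvPolynomial ℕ R) :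
    ∃ n, f ∈ supported R (Set.Iio n) := by
  obtain ⟨n, hn⟩ := f.vars.bddAbove
  exact ⟨n + 1, mem_supported.2 fun k hk => Nat.lt_succ_of_le (hn hk)⟩

end InsertVar

section Trimming

theorem mul_trimOp_eq_insertVar (i : ℕ) (A : Finset ℕ) (f : PolyRing) :
    (X i - C (tHat A i)) * trimOp i A f =
      insertVar (i + 1) (tHat A i) f - insertVar i (tHat A i) f :=
  mul_trimOp i A f

theorem X_sub_C_ne_zero {σ R : Type*} [CommRing R] [Nontrivial R] (i : σ) (a : R) :
    (X i - C a : MvPolynomial σ R) ≠ 0 := fun h => by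
  simpa using congrArg (eval fun _ => a + 1) h

theorem trimOp_eq_of_mul_eq {i : ℕ} {A : Finset ℕ} {f g : PolyRing}
    (h : (X i - C (tHat A i)) * g = insertVar (i + 1) (tHat A i) f - insertVar i (tHat A i) f) :
    trimOp i A f = g :=
  mul_left_cancel₀ (X_sub_C_ne_zero i _) ((mul_trimOp_eq_insertVar i A f).trans h.symm)

/-- The trimming operation `E_{i,A}` as a linear map. -/
noncomputable def trimLinear (i : ℕ) (A : Finset ℕ) : PolyRing →ₗ[CoeffRing] PolyRing where
  toFun := trimOp i A
  map_add' f g := trimOp_eq_of_mul_eq <| by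
    simp only [mul_add, mul_trimOp_eq_insertVar, map_add]
    ring
  map_smul' a f := trimOp_eq_of_mul_eq <| by
    simp only [mul_smul_comm, mul_trimOp_eq_insertVar, map_smul, smul_sub, RingHom.id_apply]

theorem trimOp_add (i : ℕ) (A : Finset ℕ) (f g : PolyRing) :
    trimOp i A (f + g) = trimOp i A f + trimOp i A g := map_add (trimLinear i A) f g

theorem trimOp_sub (i : ℕ) (A : Finset ℕ) (f g : PolyRing) :
    trimOp i A (f - g) = trimOp i A f - trimOp i A g := map_sub (trimLinear i A) f g

@[simp]
theorem trimOp_zero (i : ℕ) (A : Finset ℕ) : trimOp i A 0 = 0 := map_zero (trimLinear i A)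

@[simp]
theorem trimOp_C (i : ℕ) (A : Finset ℕ) (a : CoeffRing) : trimOp i A (C a) = 0 :=
  trimOp_eq_of_mul_eq (by simp only [insertVar_C, sub_self, mul_zero])

theorem trimOp_comm {i j : ℕ} (h : j < i) (A : Finset ℕ) (f : PolyRing) :
    trimOp i (starSet {j} A) (trimOp j A f) =
      trimOp j (starSet {i + 1} A) (trimOp (i + 1) A f) := by
  set a := tHat A j with ha
  set b := tHat A (i + 1) with hb
  have hleft : (X i - C b) * (X j - C a) * trimOp i (starSet {j} A) (trimOp j A f) =
      insertVar (i + 1) b (insertVar (j + 1) a f - insertVar j a f) -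
        insertVar i b (insertVar (j + 1) a f - insertVar j a f) := by
    have hij := mul_trimOp_eq_insertVar i (starSet {j} A) (trimOp j A f)
    rw [tHat_starSet_of_le h.le, ← hb] at hij
    simp only [ha, ← mul_trimOp_eq_insertVar, map_mul, map_sub, insertVar_X, insertVar_C, h,
      h.trans (Nat.lt_succ_self i), if_true]
    linear_combination (X j - C a) * hij
  have hright : (X i - C b) * (X j - C a) * trimOp j (starSet {i + 1} A) (trimOp (i + 1) A f) =
      insertVar (j + 1) a (insertVar (i + 2) b f - insertVar (i + 1) b f) -
        insertVar j a (insertVar (i + 2) b f - insertVar (i + 1) b f) := by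
    have hji := mul_trimOp_eq_insertVar j (starSet {i + 1} A) (trimOp (i + 1) A f)
    rw [tHat_starSet_of_lt (by omega), ← ha] at hji
    simp only [hb, ← mul_trimOp_eq_insertVar, map_mul, map_sub, insertVar_X, insertVar_C]
    simp only [show ¬i + 1 < j + 1 by omega, show ¬i + 1 < j by omega,
      show i + 1 ≠ j + 1 by omega, show i + 1 ≠ j by omega, if_false, Nat.add_sub_cancel]
    linear_combination (X i - C b) * hji
  apply mul_left_cancel₀ (mul_ne_zero (X_sub_C_ne_zero i b) (X_sub_C_ne_zero j a))
  rw [hleft, hright]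
  simp only [map_sub, insertVar_comm (show j + 1 ≤ i + 1 by omega),
    insertVar_comm (show j + 1 ≤ i by omega), insertVar_comm (show j ≤ i + 1 by omega),
    insertVar_comm h.le]
  ring

theorem trimOp_eq_zero_of_mem_supported {i n : ℕ} (h : n ≤ i) (A : Finset ℕ) {f : PolyRing}
    (hf : f ∈ supported CoeffRing (Set.Iio n)) : trimOp i A f = 0 :=
  trimOp_eq_of_mul_eq <| by
    rw [insertVar_of_mem_supported (h.trans i.le_succ) _ hf, insertVar_of_mem_supported h _ hf,
      sub_self, mul_zero]

theorem mem_supported_of_trimOp_eq_zero {n : ℕ} {A : Finset ℕ} {f : PolyRing}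
    (h : ∀ i, n ≤ i → trimOp i A f = 0) : f ∈ supported CoeffRing (Set.Iio n) := by
  obtain ⟨m, hm⟩ := exists_mem_supported_Iio f
  induction m with
  | zero => exact supported_mono (Set.Iio_subset_Iio (Nat.zero_le n)) hm
  | succ m ih =>
    obtain hmn | hnm := Nat.lt_or_ge m n
    · exact supported_mono (Set.Iio_subset_Iio hmn) hm
    · have hfix := mul_trimOp_eq_insertVar m A f
      rw [h m hnm, mul_zero, insertVar_of_mem_supported le_rfl _ hm] at hfix
      refine ih ?_
      rw [sub_eq_zero.1 hfix.symm]
      exact insertVar_mem_supported _ hm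

theorem trimOp_mem_supported {n : ℕ} (i : ℕ) (A : Finset ℕ) {f : PolyRing}
    (hf : f ∈ supported CoeffRing (Set.Iio n)) :
    trimOp i A f ∈ supported CoeffRing (Set.Iio n) := by
  obtain h | h := Nat.lt_or_ge i n
  · refine mem_supported_of_trimOp_eq_zero (A := starSet {i} A) fun k hk => ?_
    rw [trimOp_comm (h.trans_le hk), trimOp_eq_zero_of_mem_supported (by omega) A hf, trimOp_zero]
  · rw [trimOp_eq_zero_of_mem_supported h A hf]
    exact zero_mem _

theorem trimOp_X_sub_C_mul {n : ℕ} (A : Finset ℕ) {g : PolyRing}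
    (hg : g ∈ supported CoeffRing (Set.Iio (n + 1))) :
    trimOp n A ((X n - C (tHat A n)) * g) = g := by
  apply trimOp_eq_of_mul_eq
  simp [insertVar_X, insertVar_of_mem_supported le_rfl _ hg]

theorem eq_zero_of_trimOp_eq_zero {A : Finset ℕ} {f : PolyRing} (h : ∀ i, trimOp i A f = 0)
    (h0 : evA A f = 0) : f = 0 := by
  have hf : f ∈ supported CoeffRing (Set.Iio 0) := mem_supported_of_trimOp_eq_zero fun i _ => h i
  rw [show Set.Iio 0 = (∅ : Set ℕ) from Set.Iio_bot, supported_empty, Algebra.mem_bot] at hf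
  obtain ⟨a, rfl⟩ := hf
  rw [AlgHom.commutes, Algebra.algebraMap_self_apply] at h0
  rw [h0, map_zero]

theorem trimOp_substT (i : ℕ) (A B : Finset ℕ) (f : PolyRing) :
    trimOp i (starSet B A) (substT A f) = substT A (trimOp i B f) := by
  apply trimOp_eq_of_mul_eq
  have h := congrArg (substT A) (mul_trimOp_eq_insertVar i B f)
  simpa [substT, map_insertVar, rename_complNth_tHat] using h

theorem evA_substT (A B : Finset ℕ) (f : PolyRing) :
    evA (starSet B A) (substT A f) = rename (complNth A) (evA B f) := by
  induction f using MvPolynomial.induction_on with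
  | C a => simp [substT, evA]
  | add p q hp hq => simp only [map_add, hp, hq]
  | mul_X p k hp =>
    rw [map_mul, map_mul, hp, map_mul, map_mul]
    simp [substT, evA, rename_complNth_tHat]

end Trimming

section Words

/-- The action `(f, A) ↦ (E_{i,A} f, i ⋆ A)` of the letter `i` on pairs of a polynomial and a
weight. It turns the `⋆`-composition of trimming operations into composition of maps. -/
noncomputable def weightedTrim (i : ℕ) : Function.End (PolyRing × Finset ℕ) :=
  fun p => (trimOp i p.2 p.1, starSet {i} p.2)

theorem weightedTrim_mul_weightedTrim (i j : ℕ) (h : j < i) :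
    weightedTrim i * weightedTrim j = weightedTrim j * weightedTrim (i + 1) :=
  funext fun p => Prod.ext (trimOp_comm h p.2 p.1) (starSet_singleton_comm h p.2)

theorem prod_map_weightedTrim (w : List ℕ) (f : PolyRing) (A : Finset ℕ) :
    (w.map weightedTrim).prod (f, A) = (starComp A w f, starWeight w A) := by
  induction w with
  | nil => rfl
  | cons i w ih =>
    have h : ((i :: w).map weightedTrim).prod (f, A) =
        weightedTrim i ((w.map weightedTrim).prod (f, A)) := by
      rw [List.map_cons, List.prod_cons]
      rfl
    rw [h, ih]
    rfl

theorem starComp_append (A : Finset ℕ) (v w : List ℕ) (f : PolyRing) :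
    starComp A (v ++ w) f = starComp (starWeight w A) v (starComp A w f) := by
  have h : ((v ++ w).map weightedTrim).prod (f, A) =
      (v.map weightedTrim).prod ((w.map weightedTrim).prod (f, A)) := by
    rw [List.map_append, List.prod_append]
    rfl
  simp only [prod_map_weightedTrim] at h
  exact congrArg Prod.fst h

theorem evStar_append_singleton (A : Finset ℕ) (w : List ℕ) (i : ℕ) (f : PolyRing) :
    evStar A (w ++ [i]) f = evStar (starSet {i} A) w (trimOp i A f) := by
  rw [evStar, starComp_append, starWeight, List.foldr_append]
  rfl

theorem evStar_eq_of_prod_eq {v w : List ℕ}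
    (h : (v.map elementary).prod = (w.map elementary).prod) (A : Finset ℕ) (f : PolyRing) :
    evStar A v f = evStar A w f := by
  have hp := congrFun (prod_map_eq_of_prod_elementary_eq weightedTrim_mul_weightedTrim h) (f, A)
  rw [prod_map_weightedTrim, prod_map_weightedTrim, Prod.mk.injEq] at hp
  rw [evStar, evStar, hp.1, hp.2]

theorem evStar_eq_evStarForest (w : List ℕ) (f : PolyRing) :
    evStar ∅ w f = evStarForest (w.map elementary).prod f :=
  evStar_eq_of_prod_eq (trimmingWords_nonempty _).choose_spec.symm ∅ f

/-- The `⋆`-composition `[E_{i₁} ⋆ ⋯ ⋆ E_{i_k}]_A` as a linear map. -/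
noncomputable def starCompLinear (A : Finset ℕ) : List ℕ → PolyRing →ₗ[CoeffRing] PolyRing
  | [] => LinearMap.id
  | i :: w => trimLinear i (starWeight w A) ∘ₗ starCompLinear A w

theorem starCompLinear_apply (A : Finset ℕ) (w : List ℕ) (f : PolyRing) :
    starCompLinear A w f = starComp A w f := by
  induction w with
  | nil => rfl
  | cons i w ih => exact congrArg (trimOp i (starWeight w A)) ih

/-- The operation `[ev ⋆ E_{i₁} ⋆ ⋯ ⋆ E_{i_k}]_A` as a linear functional. -/
noncomputable def evStarLinear (A : Finset ℕ) (w : List ℕ) : PolyRing →ₗ[CoeffRing] CoeffRing :=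
  (evA (starWeight w A)).toLinearMap ∘ₗ starCompLinear A w

theorem evStarLinear_apply (A : Finset ℕ) (w : List ℕ) (f : PolyRing) :
    evStarLinear A w f = evStar A w f :=
  congrArg (evA (starWeight w A)) (starCompLinear_apply A w f)

@[simp]
theorem evStar_zero (A : Finset ℕ) (w : List ℕ) : evStar A w 0 = 0 := by
  rw [← evStarLinear_apply, map_zero]

theorem starComp_mem_supported {n : ℕ} (A : Finset ℕ) (w : List ℕ) {f : PolyRing}
    (hf : f ∈ supported CoeffRing (Set.Iio n)) :
    starComp A w f ∈ supported CoeffRing (Set.Iio n) := by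
  induction w with
  | nil => exact hf
  | cons i w ih => exact trimOp_mem_supported i _ ih

theorem starComp_eq_zero_of_mem_supported {n i : ℕ} (A : Finset ℕ) {w : List ℕ} {f : PolyRing}
    (hf : f ∈ supported CoeffRing (Set.Iio n)) (hi : i ∈ w) (hn : n ≤ i) :
    starComp A w f = 0 := by
  induction w with
  | nil => cases hi
  | cons k w ih =>
    obtain rfl | hi := List.mem_cons.1 hi
    · exact trimOp_eq_zero_of_mem_supported hn _ (starComp_mem_supported A w hf)
    · rw [starComp, ih hi, trimOp_zero]

theorem evStar_substT (A B : Finset ℕ) (w : List ℕ) (f : PolyRing) :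
    evStar (starSet B A) w (substT A f) = rename (complNth A) (evStar B w f) := by
  induction w using List.reverseRecOn generalizing B f with
  | nil => exact evA_substT A B f
  | append_singleton w i ih =>
    rw [evStar_append_singleton, evStar_append_singleton, trimOp_substT, ← starSet_assoc, ih]

theorem evStar_empty_substT (A : Finset ℕ) (w : List ℕ) (f : PolyRing) :
    evStar A w (substT A f) = rename (complNth A) (evStar ∅ w f) := by
  rw [← evStar_substT, empty_starSet]

end Words

section Homogeneity

theorem mem_of_mul_mem_graded {ι A σ : Type*} [DecidableEq ι] [AddLeftCancelMonoid ι] [Semiring A]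
    [NoZeroDivisors A] [SetLike σ A] [AddSubmonoidClass σ A] (𝒜 : ι → σ) [GradedRing 𝒜]
    {i j : ι} {a b : A} (ha : a ∈ 𝒜 i) (ha0 : a ≠ 0) (hab : a * b ∈ 𝒜 (i + j)) : b ∈ 𝒜 j := by
  have hzero : ∀ k, k ≠ j → (DirectSum.decompose 𝒜 b k : A) = 0 := fun k hk => by
    have h := DirectSum.coe_decompose_mul_add_of_left_mem 𝒜 (j := k) (b := b) ha
    rw [DirectSum.decompose_of_mem_ne 𝒜 hab fun e => hk (add_left_cancel e).symm] at h
    exact (mul_eq_zero.1 h.symm).resolve_left ha0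
  classical
  rw [← DirectSum.sum_support_decompose 𝒜 b]
  refine sum_mem fun k _ => ?_
  by_cases hk : k = j
  · exact hk ▸ SetLike.coe_mem _
  · rw [hzero k hk]
    exact zero_mem _

/-- The polynomials in `ℤ[t][x]` that are homogeneous of degree `d` jointly in `x` and `t`. -/
noncomputable def jointlyHomogeneous (d : ℕ) : Submodule ℤ PolyRing :=
  (homogeneousSubmodule (ℕ ⊕ ℕ) ℤ d).comap (sumAlgEquiv ℤ ℕ ℕ).symm.toLinearMap

variable {d e : ℕ} {f g : PolyRing}

theorem mem_jointlyHomogeneous :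
    f ∈ jointlyHomogeneous d ↔ ((sumAlgEquiv ℤ ℕ ℕ).symm f).IsHomogeneous d := Iff.rfl

theorem X_mem_jointlyHomogeneous (i : ℕ) : X i ∈ jointlyHomogeneous 1 := by
  rw [mem_jointlyHomogeneous, sumAlgEquiv_symm_X]
  exact isHomogeneous_X _ _

theorem C_X_mem_jointlyHomogeneous (i : ℕ) : C (X i) ∈ jointlyHomogeneous 1 := by
  rw [mem_jointlyHomogeneous, sumAlgEquiv_symm_C_X]
  exact isHomogeneous_X _ _

theorem one_mem_jointlyHomogeneous : 1 ∈ jointlyHomogeneous 0 := by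
  rw [mem_jointlyHomogeneous, map_one]
  exact isHomogeneous_one _ _

theorem mul_mem_jointlyHomogeneous (hf : f ∈ jointlyHomogeneous d) (hg : g ∈ jointlyHomogeneous e) :
    f * g ∈ jointlyHomogeneous (d + e) := by
  rw [mem_jointlyHomogeneous, map_mul]
  exact IsHomogeneous.mul hf hg

theorem mem_jointlyHomogeneous_of_mul_mem (hf : f ∈ jointlyHomogeneous d) (hf0 : f ≠ 0)
    (h : f * g ∈ jointlyHomogeneous (d + e)) : g ∈ jointlyHomogeneous e := by
  rw [mem_jointlyHomogeneous, map_mul] at h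
  let _ := gradedAlgebra (σ := ℕ ⊕ ℕ) (R := ℤ)
  exact mem_of_mul_mem_graded (homogeneousSubmodule (ℕ ⊕ ℕ) ℤ) hf (by simpa using hf0) h

theorem exists_eq_C_of_mem_jointlyHomogeneous (hf : f ∈ jointlyHomogeneous 0) : ∃ a, f = C a := by
  rw [mem_jointlyHomogeneous, ← totalDegree_zero_iff_isHomogeneous,
    totalDegree_eq_zero_iff_eq_C] at hf
  exact ⟨C _, by rw [← sumAlgEquiv_C_inl, ← hf, AlgEquiv.apply_symm_apply]⟩

theorem exists_eq_sum_jointlyHomogeneous (f : PolyRing) :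
    ∃ (d : ℕ) (g : ℕ → PolyRing), (∀ k, g k ∈ jointlyHomogeneous k) ∧
      f = ∑ k ∈ Finset.range d, g k := by
  let p := (sumAlgEquiv ℤ ℕ ℕ).symm f
  refine ⟨p.totalDegree + 1, fun k => sumAlgEquiv ℤ ℕ ℕ (homogeneousComponent k p),
    fun k => ?_, ?_⟩
  · rw [mem_jointlyHomogeneous, AlgEquiv.symm_apply_apply]
    exact homogeneousComponent_isHomogeneous k p
  · rw [← map_sum, sum_homogeneousComponent, AlgEquiv.apply_symm_apply]

theorem map_mem_jointlyHomogeneous (φ : PolyRing →+* PolyRing)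
    (hX : ∀ i, φ (X i) ∈ jointlyHomogeneous 1) (hC : ∀ i, φ (C (X i)) ∈ jointlyHomogeneous 1)
    (hf : f ∈ jointlyHomogeneous d) : φ f ∈ jointlyHomogeneous d := by
  let ψ : MvPolynomial (ℕ ⊕ ℕ) ℤ →ₐ[ℤ] MvPolynomial (ℕ ⊕ ℕ) ℤ :=
    ((sumAlgEquiv ℤ ℕ ℕ).symm.toAlgHom.comp φ.toIntAlgHom).comp (sumAlgEquiv ℤ ℕ ℕ).toAlgHom
  have hψ : ∀ p, ψ p = (sumAlgEquiv ℤ ℕ ℕ).symm (φ (sumAlgEquiv ℤ ℕ ℕ p)) := fun _ => rfl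
  have hψX : ∀ v, (ψ (X v)).IsHomogeneous 1 := by
    rintro (i | i)
    · simpa [hψ, mem_jointlyHomogeneous] using hX i
    · simpa [hψ, mem_jointlyHomogeneous] using hC i
  have hφ : (sumAlgEquiv ℤ ℕ ℕ).symm (φ f) =
      aeval (fun v => ψ (X v)) ((sumAlgEquiv ℤ ℕ ℕ).symm f) := by
    refine Eq.trans ?_ (DFunLike.congr_fun (aeval_unique ψ) _)
    rw [hψ, AlgEquiv.apply_symm_apply]
  rw [mem_jointlyHomogeneous, hφ]
  simpa only [one_mul] using (mem_jointlyHomogeneous.1 hf).aeval (fun v => ψ (X v)) hψX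

theorem C_tHat_mem_jointlyHomogeneous (A : Finset ℕ) (i : ℕ) :
    C (tHat A i) ∈ jointlyHomogeneous 1 := C_X_mem_jointlyHomogeneous _

theorem X_sub_C_tHat_mem_jointlyHomogeneous (A : Finset ℕ) (i : ℕ) :
    X i - C (tHat A i) ∈ jointlyHomogeneous 1 :=
  sub_mem (X_mem_jointlyHomogeneous i) (C_tHat_mem_jointlyHomogeneous A i)

theorem insertVar_tHat_mem_jointlyHomogeneous (k i : ℕ) (A : Finset ℕ)
    (hf : f ∈ jointlyHomogeneous d) : insertVar k (tHat A i) f ∈ jointlyHomogeneous d := by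
  refine map_mem_jointlyHomogeneous (insertVar k (tHat A i) : PolyRing →+* PolyRing)
    (fun j => ?_) (fun j => ?_) hf
  · rw [RingHom.coe_coe, insertVar_X]
    split_ifs
    exacts [X_mem_jointlyHomogeneous _, C_tHat_mem_jointlyHomogeneous _ _,
      X_mem_jointlyHomogeneous _]
  · rw [RingHom.coe_coe, insertVar_C]
    exact C_X_mem_jointlyHomogeneous _

theorem trimOp_mem_jointlyHomogeneous (i : ℕ) (A : Finset ℕ)
    (hf : f ∈ jointlyHomogeneous (d + 1)) : trimOp i A f ∈ jointlyHomogeneous d := by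
  refine mem_jointlyHomogeneous_of_mul_mem (X_sub_C_tHat_mem_jointlyHomogeneous A i)
    (X_sub_C_ne_zero _ _) ?_
  rw [mul_trimOp_eq_insertVar, add_comm]
  exact sub_mem (insertVar_tHat_mem_jointlyHomogeneous _ _ _ hf)
    (insertVar_tHat_mem_jointlyHomogeneous _ _ _ hf)

theorem substT_mem_jointlyHomogeneous (A : Finset ℕ) (hf : f ∈ jointlyHomogeneous d) :
    substT A f ∈ jointlyHomogeneous d :=
  map_mem_jointlyHomogeneous (substT A)
    (fun i => by simpa [substT] using X_mem_jointlyHomogeneous i)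
    (fun i => by simpa [substT] using C_X_mem_jointlyHomogeneous (complNth A i)) hf

theorem C_evA_mem_jointlyHomogeneous (A : Finset ℕ) (hf : f ∈ jointlyHomogeneous d) :
    C (evA A f) ∈ jointlyHomogeneous d :=
  map_mem_jointlyHomogeneous (C.comp (evA A : PolyRing →+* CoeffRing))
    (fun i => by simpa [evA] using C_tHat_mem_jointlyHomogeneous A i)
    (fun i => by simpa [evA] using C_X_mem_jointlyHomogeneous i) hf

theorem starComp_mem_jointlyHomogeneous (A : Finset ℕ) (w : List ℕ)
    (hf : f ∈ jointlyHomogeneous (d + w.length)) : starComp A w f ∈ jointlyHomogeneous d := by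
  induction w generalizing d with
  | nil => exact hf
  | cons i w ih =>
    exact trimOp_mem_jointlyHomogeneous i _ (ih (by simpa [add_assoc, add_comm 1] using hf))

theorem starComp_eq_zero_of_lt_length (A : Finset ℕ) {w : List ℕ} (hf : f ∈ jointlyHomogeneous d)
    (hw : d < w.length) : starComp A w f = 0 := by
  induction w with
  | nil => simp at hw
  | cons i w ih =>
    obtain hlt | rfl := lt_or_eq_of_le (Nat.le_of_lt_succ hw)
    · rw [starComp, ih hlt, trimOp_zero]
    · obtain ⟨a, ha⟩ := exists_eq_C_of_mem_jointlyHomogeneous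
        (starComp_mem_jointlyHomogeneous (d := 0) A w (by rwa [zero_add]))
      rw [starComp, ha, trimOp_C]

theorem exists_starComp_eq_zero_of_le_length (f : PolyRing) :
    ∃ d, ∀ A w, d ≤ w.length → starComp A w f = 0 := by
  obtain ⟨d, g, hg, rfl⟩ := exists_eq_sum_jointlyHomogeneous f
  refine ⟨d, fun A w hw => ?_⟩
  rw [← starCompLinear_apply, map_sum]
  refine Finset.sum_eq_zero fun k hk => ?_
  rw [starCompLinear_apply]
  exact starComp_eq_zero_of_lt_length A (hg k) ((Finset.mem_range.1 hk).trans_le hw)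

end Homogeneity

section Separation

theorem eq_zero_of_evStar_eq_zero {A : Finset ℕ} {f : PolyRing} (h : ∀ w, evStar A w f = 0) :
    f = 0 := by
  obtain ⟨d, hd⟩ := exists_starComp_eq_zero_of_le_length f
  replace hd := hd A
  induction d generalizing A f with
  | zero => exact hd [] (Nat.zero_le _)
  | succ d ih =>
    refine eq_zero_of_trimOp_eq_zero (A := A) (fun i => ?_) (h [])
    refine ih (A := starSet {i} A) (fun w => ?_) fun w hw => ?_
    · rw [← evStar_append_singleton, h]
    · exact (starComp_append A w [i] f).symm.trans (hd (w ++ [i]) (by simpa using hw))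

theorem eq_of_evStar_eq {A : Finset ℕ} {f g : PolyRing} (h : ∀ w, evStar A w f = evStar A w g) :
    f = g :=
  sub_eq_zero.1 <| eq_zero_of_evStar_eq_zero (A := A) fun w => by
    rw [← evStarLinear_apply, map_sub, evStarLinear_apply, evStarLinear_apply, h, sub_self]

end Separation

section Duality

theorem exists_trimOp_eq (A : Finset ℕ) {d : ℕ} (n : ℕ) (g : ℕ → PolyRing)
    (hcomm : ∀ i j, j < i →
      trimOp i (starSet {j} A) (g j) = trimOp j (starSet {i + 1} A) (g (i + 1)))
    (hn : ∀ i, n ≤ i → g i = 0) (hd : ∀ i, g i ∈ jointlyHomogeneous d) :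
    ∃ f ∈ jointlyHomogeneous (d + 1), ∀ i, trimOp i A f = g i := by
  induction n generalizing g with
  | zero => exact ⟨0, zero_mem _, fun i => by rw [trimOp_zero, hn i (Nat.zero_le i)]⟩
  | succ n ih =>
    have hgn : g n ∈ supported CoeffRing (Set.Iio (n + 1)) :=
      mem_supported_of_trimOp_eq_zero (A := starSet {n} A) fun i hi => by
        rw [hcomm i n hi, hn (i + 1) (by omega), trimOp_zero]
    -- `f₁` has the right `n`-th trimming, so subtracting it leaves a family that stops before `n`.
    set f₁ : PolyRing := (X n - C (tHat A n)) * g n with hf₁_def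
    have hf₁ : f₁ ∈ jointlyHomogeneous (d + 1) :=
      add_comm 1 d ▸
        mul_mem_jointlyHomogeneous (X_sub_C_tHat_mem_jointlyHomogeneous A n) (hd n)
    have hf₁_supp : f₁ ∈ supported CoeffRing (Set.Iio (n + 1)) :=
      mul_mem (sub_mem (X_mem_supported.2 n.lt_succ_self) (Subalgebra.algebraMap_mem _ _)) hgn
    obtain ⟨f₂, hf₂, hf₂g⟩ := ih (fun i => g i - trimOp i A f₁)
      (fun i j hij => by rw [trimOp_sub, trimOp_sub, hcomm i j hij, trimOp_comm hij])
      (fun i hi => by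
        obtain rfl | hi := hi.eq_or_lt
        · rw [hf₁_def, trimOp_X_sub_C_mul A hgn, sub_self]
        · rw [hn i hi, trimOp_eq_zero_of_mem_supported hi A hf₁_supp, sub_self])
      fun i => sub_mem (hd i) (trimOp_mem_jointlyHomogeneous i A hf₁)
    exact ⟨f₂ + f₁, add_mem hf₂ hf₁, fun i => by rw [trimOp_add, hf₂g, sub_add_cancel]⟩

open Classical in
/-- The polynomial `p` is dual to the forest `F`: among the operators `[ev ⋆ E_G]`, those with
`G = F` take the value `1` at `p` and those with `G ≠ F` the value `0`. The operators are indexed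
by factorizations, so that duality can be checked letter by letter. -/
def IsDualTo (F : IndexedForest) (p : PolyRing) : Prop :=
  ∀ w : List ℕ, evStar ∅ w p = if (w.map elementary).prod = F then 1 else 0

variable {F : IndexedForest} {p q : PolyRing}

theorem IsDualTo.unique (hp : IsDualTo F p) (hq : IsDualTo F q) : p = q :=
  eq_of_evStar_eq fun w => (hp w).trans (hq w).symm

open Classical in
theorem evStar_ite_substT {i : ℕ} (hq : i ∈ F.qDes → IsDualTo (F.trim i) q) (w : List ℕ) :
    evStar {i} w (if i ∈ F.qDes then substT {i} q else 0) =
      if (w.map elementary).prod * elementary i = F then 1 else 0 := by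
  simp only [mul_elementary_eq_iff]
  by_cases hi : i ∈ F.qDes
  · simp only [hi, if_true, true_and, eq_comm (a := F.trim i)]
    rw [evStar_empty_substT, hq hi w]
    split_ifs <;> simp
  · simp [hi]

open Classical in
theorem IsDualTo.trimOp_eq {i : ℕ} (hp : IsDualTo F p)
    (hq : i ∈ F.qDes → IsDualTo (F.trim i) q) :
    trimOp i ∅ p = if i ∈ F.qDes then substT {i} q else 0 := by
  refine eq_of_evStar_eq (A := {i}) fun w => ?_
  have h := hp (w ++ [i])
  rw [evStar_append_singleton, starSet_empty, List.map_append, List.prod_append] at h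
  simpa only [evStar_ite_substT hq, List.map_singleton, List.prod_singleton] using h

open Classical in
theorem isDualTo_of_trimOp_eq {q : ℕ → PolyRing} (h : evA ∅ p = if F = 1 then 1 else 0)
    (hp : ∀ i, trimOp i ∅ p = if i ∈ F.qDes then substT {i} (q i) else 0)
    (hq : ∀ i ∈ F.qDes, IsDualTo (F.trim i) (q i)) : IsDualTo F p := by
  intro w
  induction w using List.reverseRecOn with
  | nil => exact h.trans (if_congr eq_comm rfl rfl)
  | append_singleton w i =>
    rw [evStar_append_singleton, hp, starSet_empty, evStar_ite_substT (hq i), List.map_append,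
      List.prod_append, List.map_singleton, List.prod_singleton]

theorem isDualTo_one : IsDualTo 1 1 :=
  isDualTo_of_trimOp_eq (q := 0) (by simp)
    (fun i => by rw [← C_1, trimOp_C, qDes_one, if_neg (Set.notMem_empty i)])
    (fun i hi => by simp [qDes_one] at hi)

open Classical in
theorem exists_trimOp_eq_ite_substT {d : ℕ} {q : ℕ → PolyRing}
    (hd : ∀ i, q i ∈ jointlyHomogeneous d) (hq : ∀ i ∈ F.qDes, IsDualTo (F.trim i) (q i)) :
    ∃ f ∈ jointlyHomogeneous (d + 1),
      ∀ i, trimOp i ∅ f = if i ∈ F.qDes then substT {i} (q i) else 0 := by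
  obtain ⟨n, hn⟩ := F.bddAbove_qDes
  refine exists_trimOp_eq ∅ (n + 1) _ (fun i j hij => ?_) (fun i hi => ?_) fun i => ?_
  · refine eq_of_evStar_eq (A := starSet {i} (starSet {j} ∅)) fun w => ?_
    rw [← evStar_append_singleton, starSet_singleton_comm hij, ← evStar_append_singleton,
      starSet_empty, starSet_empty, evStar_ite_substT (hq j), evStar_ite_substT (hq (i + 1))]
    simp only [List.map_append, List.prod_append, List.map_singleton, List.prod_singleton,
      mul_assoc, elementary_mul_elementary hij]
  · exact if_neg fun h => (hn h).not_gt hi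
  · split_ifs
    exacts [substT_mem_jointlyHomogeneous _ (hd i), zero_mem _]

theorem exists_isDualTo (F : IndexedForest) : ∃ p ∈ jointlyHomogeneous F.size, IsDualTo F p := by
  induction hn : F.size generalizing F with
  | zero =>
    obtain rfl := size_eq_zero_iff.1 hn
    exact ⟨1, one_mem_jointlyHomogeneous, isDualTo_one⟩
  | succ n ih =>
    have hq : ∀ i, ∃ q ∈ jointlyHomogeneous n, i ∈ F.qDes → IsDualTo (F.trim i) q := by
      intro i
      by_cases hi : i ∈ F.qDes
      · obtain ⟨q, hqn, hq⟩ := ih (F.trim i) (by have := size_trim_add_one hi; omega)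
        exact ⟨q, hqn, fun _ => hq⟩
      · exact ⟨0, zero_mem _, fun h => absurd h hi⟩
    choose q hqn hq using hq
    obtain ⟨f, hfn, hf⟩ := exists_trimOp_eq_ite_substT hqn hq
    -- Subtracting the constant `f(t; t)` normalizes `f` without changing its trimmings.
    refine ⟨f - C (evA ∅ f), sub_mem hfn (C_evA_mem_jointlyHomogeneous ∅ hfn),
      isDualTo_of_trimOp_eq ?_ (fun i => ?_) hq⟩
    · have hF : F ≠ 1 := fun h => by simp [size_eq_zero_iff.2 h] at hn
      simp [evA, hF]
    · rw [trimOp_sub, trimOp_C, sub_zero, hf]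

theorem IsDoubleForestFamily.isDualTo {P : IndexedForest → PolyRing} (hP : IsDoubleForestFamily P)
    (F : IndexedForest) : IsDualTo F (P F) := by
  induction hn : F.size using Nat.strong_induction_on generalizing F with
  | _ n ih =>
    refine isDualTo_of_trimOp_eq (hP.normalization F) (hP.recursion F) fun i hi => ?_
    exact ih _ (by have := size_trim_add_one hi; omega) _ rfl

theorem exists_isDoubleForestFamily : ∃ P, IsDoubleForestFamily P := by
  classical
  choose P hhom hdual using exists_isDualTo
  refine ⟨P, fun F => ⟨_, hhom F⟩, fun F => ?_, fun F i => ?_⟩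
  · exact (hdual F []).trans (if_congr eq_comm rfl rfl)
  · exact (hdual F).trimOp_eq fun _ => hdual (F.trim i)

theorem isDoubleForestFamily_doubleForest : IsDoubleForestFamily doubleForest :=
  Classical.epsilon_spec exists_isDoubleForestFamily

end Duality

section Expansion

theorem finite_evStarForest_ne_zero (f : PolyRing) :
    {F : IndexedForest | evStarForest F f ≠ 0}.Finite := by
  obtain ⟨d, hd⟩ := exists_starComp_eq_zero_of_le_length f
  obtain ⟨n, hn⟩ := exists_mem_supported_Iio f
  refine ((List.finite_length_lt (Fin n) d).image
    fun w => ((w.map Fin.val).map elementary).prod).subset fun F hF => ?_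
  obtain ⟨w, rfl⟩ := F.trimmingWords_nonempty
  have hw : starComp ∅ w f ≠ 0 := fun h => hF <| by
    rw [← evStar_eq_evStarForest, evStar, h, map_zero]
  have hletters : ∀ i ∈ w, i < n := fun i hi => lt_of_not_ge fun hni =>
    hw (starComp_eq_zero_of_mem_supported ∅ hn hi hni)
  obtain ⟨u, rfl⟩ : w ∈ Set.range (List.map (Fin.val : Fin n → ℕ)) := by
    rw [Set.range_list_map]
    exact fun i hi => ⟨⟨i, hletters i hi⟩, rfl⟩
  refine ⟨u, show u.length < d from lt_of_not_ge fun hu => hw (hd _ _ ?_), rfl⟩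
  rwa [List.length_map]

theorem eq_finsum_evStarForest (f : PolyRing) :
    f = ∑ᶠ F : IndexedForest, evStarForest F f • doubleForest F := by
  classical
  have hfin := finite_evStarForest_ne_zero f
  rw [finsum_eq_sum_of_support_subset (s := hfin.toFinset) _ fun F hF => by
    simpa using left_ne_zero_of_smul hF]
  refine eq_of_evStar_eq (A := ∅) fun w => ?_
  calc evStar ∅ w f = evStarForest (w.map elementary).prod f := evStar_eq_evStarForest w f
    _ = ∑ F ∈ hfin.toFinset, evStarForest F f • evStar ∅ w (doubleForest F) := by
      simp only [isDoubleForestFamily_doubleForest.isDualTo _ w, smul_eq_mul, mul_ite, mul_one,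
        mul_zero, Finset.sum_ite_eq]
      simp +contextual
    _ = evStar ∅ w (∑ F ∈ hfin.toFinset, evStarForest F f • doubleForest F) := by
      simp only [← evStarLinear_apply, map_sum, map_smul]

end Expansion

end DoubleForest

theorem theorem10p5 :
    -- the double forest polynomials are well defined
    (IsDoubleForestFamily doubleForest ∧
      ∀ P : IndexedForest → PolyRing, IsDoubleForestFamily P → P = doubleForest) ∧
    -- the operator `[ev ⋆ E_F]` can be computed along any factorization of `F`
    (∀ (F : IndexedForest), ∀ w ∈ F.trimmingWords, ∀ f : PolyRing,
      evStar ∅ w f = evStarForest F f) ∧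
    -- the expansion, a finite sum
    ∀ f : PolyRing, {F : IndexedForest | evStarForest F f ≠ 0}.Finite ∧
      f = ∑ᶠ F : IndexedForest, evStarForest F f • doubleForest F := by
  refine ⟨⟨isDoubleForestFamily_doubleForest, fun P hP => funext fun F => ?_⟩, ?_, fun f =>
    ⟨finite_evStarForest_ne_zero f, eq_finsum_evStarForest f⟩⟩
  · exact (hP.isDualTo F).unique (isDoubleForestFamily_doubleForest.isDualTo F)
  · rintro F w rfl f
    exact evStar_eq_evStarForest w f
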